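/- Let $d \ge 2$. A $d$-kite is a non-degenerate $d$-simplex $K$ in Euclidean space $\mathbb{E}^d$ in which some $d$ vertices form a regular simplex (the base), with all edges of length $s$, and the remaining vertex (the apex) is at the same distance $t$ from all of them. Let $K$ be a $d$-kite with parameters $s,t$ and put $\epsilon = t/s$ (its eccentricity). Let $R$, $h$, $V$, $r$ be, respectively, the circumradius of $K$, the altitude of $K$ from the apex to the base, the volume of $K$, and the inradius of $K$. Then $$R = \sqrt{\frac{d}{2\left(2\epsilon^2 d-(d-1)\right)}}\;\epsilon^2 s,\qquad h = \sqrt{\frac{2\epsilon^2 d-(d-1)}{2d}}\;s,$$ $$V = \frac{1}{d!}\sqrt{\frac{2\epsilon^2 d-(d-1)}{2^d}}\;s^d,\qquad r = \frac{\sqrt{2\epsilon^2 d-(d-1)}}{\sqrt2\left(\sqrt d + d\sqrt{2\epsilon^2(d-1)-(d-2)}\right)}\;s.$$ Moreover: 1. the set of values of $\epsilon^2$ attained by $d$-kites is exactly the open interval $\left(\frac{d-1}{2d},\infty\right)$; 2. the circumcenter of $K$ is interior to $K$ if and only if $\epsilon^2 > \frac{d-1}{d}$; 3. $K$ is equiradial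 (all its facets have the same circumradius) if and only if $\epsilon^2 = \frac{d-2}{d}$ or $\epsilon = 1$; 4. the $d+1$ altitudes of $K$ (the lines through a vertex perpendicular to the opposite facet) have exactly one common point, the orthocenter of $K$, and it is interior to $K$ if and only if $\epsilon^2 > \frac12$. -/

import Mathlib

/-- `K` is a `d`-kite with apex `K.points a`: the `d` vertices other than the apex form a regular
simplex (the base), all of whose edges have length `s`, and the apex has the same distance `t`
from all of them. -/
def IsKite {d : ℕ} (K : Affine.Simplex ℝ (EuclideanSpace ℝ (Fin d)) d) (a : Fin (d + 1))
    (s t : ℝ) : Prop :=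
  (∀ i j, i ≠ a → j ≠ a → i ≠ j → dist (K.points i) (K.points j) = s) ∧
    ∀ i, i ≠ a → dist (K.points i) (K.points a) = t

/-- `H` is an orthocenter of `K`: a point common to all altitudes of `K`. -/
def IsOrthocenter {d : ℕ} (K : Affine.Simplex ℝ (EuclideanSpace ℝ (Fin d)) d)
    (H : EuclideanSpace ℝ (Fin d)) : Prop :=
  ∀ i, H ∈ K.altitude i

/-- A simplex is equiradial if all its facets have the same circumradius. -/
def IsEquiradial {d : ℕ} [NeZero d] (K : Affine.Simplex ℝ (EuclideanSpace ℝ (Fin d)) d) : Prop :=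
  ∀ i j, (K.faceOpposite i).circumradius = (K.faceOpposite j).circumradius

/-!
The edge vectors of a kite at its apex have a very simple Gram matrix: by the law of cosines every
off-diagonal entry is `c = t ^ 2 - s ^ 2 / 2`, and the diagonal entries are `c + s ^ 2 / 2`
(`IsKite.inner_edge`). Its eigenvalues are `s ^ 2 / 2` and
`d * c + s ^ 2 / 2 = s ^ 2 / 2 * (2 * ε ^ 2 * d - (d - 1))`, where `ε = t / s`. The latter is
positive because the simplex is nondegenerate (`IsKite.gram_pos`), which is the bound on `ε`; and
conversely `exists_isKite` realizes every Gram matrix of this shape with positive eigenvalues.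

All distinguished points are written in the affine frame at the apex
(`Affine.Simplex.framePoint`), where the Gram matrix reduces distances and orthogonality to sums of
coordinates, and where interior points are those with positive barycentric coordinates. By symmetry
the circumcenter, the orthocenter and the foot of the altitude from the apex have equal coordinates,
and the circumcenter of a lateral facet or the foot of the altitude onto it has one coordinate zero
and the others equal. The values are forced by one linear equation each, and then checked against
the characterizations of these points. Such a check suffices: a point of the span equidistant from
the vertices is the circumcenter, and a simplex of dimension at least two has at most one
orthocenter (`IsOrthocenter.eq`).

The inradius follows from the heights, since its reciprocal is the sum of theirs. The volume is
`1 / d!` times the square root of the Gram determinant (`Affine.Simplex.volume_convexHull`). Here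
the volume `1 / d!` of the standard corner simplex is found by slicing (`volume_corner_simplex`),
and the Gram determinant comes from the matrix determinant lemma.
-/

open scoped RealInnerProductSpace

/-! ### Circumradii, heights and altitudes of a general simplex -/

namespace Affine.Simplex

variable {V P : Type*} [NormedAddCommGroup V] [InnerProductSpace ℝ V] [MetricSpace P]
  [NormedAddTorsor V P] {n : ℕ}

lemma inner_eq_zero_of_mem_vectorSpan {S : Set P} {u w : V}
    (h : ∀ p ∈ S, ∀ q ∈ S, ⟪p -ᵥ q, w⟫ = 0) (hu : u ∈ vectorSpan ℝ S) : ⟪u, w⟫ = 0 := by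
  rw [vectorSpan_def] at hu
  induction hu using Submodule.span_induction with
  | mem u hu =>
    obtain ⟨p, hp, q, hq, rfl⟩ := hu
    exact h p hp q hq
  | zero => simp
  | add u v _ _ hu hv => rw [inner_add_left, hu, hv, add_zero]
  | smul c u _ hu => rw [inner_smul_left, hu, mul_zero]

lemma circumradius_faceOpposite_eq [NeZero n] (K : Simplex ℝ P n) {i : Fin (n + 1)} {p : P} {r : ℝ}
    (hp : p ∈ affineSpan ℝ (Set.range (K.faceOpposite i).points))
    (hr : ∀ j, j ≠ i → dist (K.points j) p = r) : (K.faceOpposite i).circumradius = r := by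
  refine ((K.faceOpposite i).eq_circumradius_of_dist_eq hp fun j ↦ ?_).symm
  rw [faceOpposite_point_eq_point_succAbove]
  exact hr _ (Fin.succAbove_ne _ _)

lemma height_eq_dist_of_inner_eq_zero [NeZero n] (K : Simplex ℝ P n) {i : Fin (n + 1)} {p : P}
    (hp : p ∈ affineSpan ℝ (Set.range (K.faceOpposite i).points))
    (hi : ∀ j, j ≠ i → ⟪K.points j -ᵥ p, K.points i -ᵥ p⟫ = 0) :
    K.height i = dist (K.points i) p := by
  have h : K.altitudeFoot i = p := by
    rw [altitudeFoot, orthogonalProjectionSpan,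
      EuclideanGeometry.coe_orthogonalProjection_eq_iff_mem]
    refine ⟨hp, ?_⟩
    rw [direction_affineSpan, range_faceOpposite_points, Submodule.mem_orthogonal]
    refine fun u hu ↦ inner_eq_zero_of_mem_vectorSpan ?_ hu
    rintro _ ⟨j, hj, rfl⟩ _ ⟨k, hk, rfl⟩
    rw [← vsub_sub_vsub_cancel_right (K.points j) (K.points k) p, inner_sub_left, hi j hj, hi k hk,
      sub_zero]
  rw [height, h]

lemma mem_altitude_iff_inner (K : Simplex ℝ P n) (i : Fin (n + 1)) {x : P}
    (hx : x ∈ affineSpan ℝ (Set.range K.points)) :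
    x ∈ K.altitude i ↔
      ∀ j k, j ≠ i → k ≠ i → ⟪K.points j -ᵥ K.points k, x -ᵥ K.points i⟫ = 0 := by
  rw [altitude_def, AffineSubspace.mem_inf_iff, AffineSubspace.mem_mk', direction_affineSpan,
    Submodule.mem_orthogonal, and_iff_left hx]
  constructor
  · intro h j k hj hk
    exact h _ (vsub_mem_vectorSpan ℝ ⟨j, hj, rfl⟩ ⟨k, hk, rfl⟩)
  · intro h u hu
    refine inner_eq_zero_of_mem_vectorSpan ?_ hu
    rintro _ ⟨j, hj, rfl⟩ _ ⟨k, hk, rfl⟩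
    exact h j k hj hk

lemma affineSpan_range_eq_top {d : ℕ} (K : Simplex ℝ (EuclideanSpace ℝ (Fin d)) d) :
    affineSpan ℝ (Set.range K.points) = ⊤ := by
  rw [K.independent.affineSpan_eq_top_iff_card_eq_finrank_add_one]
  simp

end Affine.Simplex

/-- The difference of two orthocenters is orthogonal to every edge of every facet, hence to every
edge, hence zero. -/
lemma IsOrthocenter.eq {d : ℕ} (hd : 2 ≤ d) {K : Affine.Simplex ℝ (EuclideanSpace ℝ (Fin d)) d}
    {X Y : EuclideanSpace ℝ (Fin d)} (hX : IsOrthocenter K X) (hY : IsOrthocenter K Y) :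
    X = Y := by
  have hm (Z : EuclideanSpace ℝ (Fin d)) : Z ∈ affineSpan ℝ (Set.range K.points) := by
    simp [K.affineSpan_range_eq_top]
  have key : ∀ j k, ⟪K.points j -ᵥ K.points k, X - Y⟫ = 0 := by
    intro j k
    -- in dimension at least two, some facet contains both vertices
    obtain ⟨i, hi, hk⟩ := Fin.exists_ne_and_ne_of_two_lt j k (by omega)
    have h1 := (K.mem_altitude_iff_inner i (hm X)).1 (hX i) j k hi.symm hk.symm
    have h2 := (K.mem_altitude_iff_inner i (hm Y)).1 (hY i) j k hi.symm hk.symm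
    rw [vsub_eq_sub X] at h1
    rw [vsub_eq_sub Y] at h2
    rw [← sub_sub_sub_cancel_right X Y (K.points i), inner_sub_right, h1, h2, sub_zero]
  have hmem : X - Y ∈ vectorSpan ℝ (Set.range K.points) := by
    rw [← direction_affineSpan, K.affineSpan_range_eq_top]; simp
  refine sub_eq_zero.1 (inner_self_eq_zero.1
    (Affine.Simplex.inner_eq_zero_of_mem_vectorSpan ?_ hmem))
  rintro _ ⟨j, rfl⟩ _ ⟨k, rfl⟩
  exact key j k

/-! ### Points of a simplex in coordinates based at a vertex -/

namespace Affine.Simplex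

variable {d : ℕ} (K : Simplex ℝ (EuclideanSpace ℝ (Fin d)) d) (a : Fin (d + 1))

/-- The edge vector of `K` from the vertex `a` to the `k`-th of the other vertices, which are
indexed by `Fin d` through `a.succAbove`. -/
noncomputable def edge (k : Fin d) : EuclideanSpace ℝ (Fin d) :=
  K.points (a.succAbove k) - K.points a

/-- The point with affine coordinates `x` in the frame formed by the vertex `a` and the edge
vectors at `a`; its barycentric coordinates are `x` and, at `a`, `1 - ∑ k, x k`. -/
noncomputable def framePoint (x : Fin d → ℝ) : EuclideanSpace ℝ (Fin d) :=
  K.points a + ∑ k, x k • K.edge a k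

variable (x : Fin d → ℝ)

lemma sum_frameWeights : ∑ i, (a.insertNth (1 - ∑ k, x k) x : Fin (d + 1) → ℝ) i = 1 := by
  simp [Fin.sum_univ_succAbove _ a]

lemma framePoint_eq_affineCombination : K.framePoint a x =
    Finset.univ.affineCombination ℝ K.points (a.insertNth (1 - ∑ k, x k) x) := by
  rw [Finset.univ.affineCombination_eq_linear_combination _ _ (sum_frameWeights a x),
    Fin.sum_univ_succAbove _ a]
  simp only [framePoint, edge, Fin.insertNth_apply_same, Fin.insertNth_apply_succAbove, smul_sub,
    Finset.sum_sub_distrib, sub_smul, one_smul, Finset.sum_smul]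
  abel

lemma exists_eq_framePoint (p : EuclideanSpace ℝ (Fin d)) : ∃ x, p = K.framePoint a x := by
  have hp : p ∈ affineSpan ℝ (Set.range K.points) := by simp [K.affineSpan_range_eq_top]
  obtain ⟨w, hw, rfl⟩ := eq_affineCombination_of_mem_affineSpan_of_fintype hp
  refine ⟨a.removeNth w, ?_⟩
  have : 1 - ∑ k, a.removeNth w k = w a := by
    rw [← hw, Fin.sum_univ_succAbove _ a]
    simp [Fin.removeNth]
  rw [framePoint_eq_affineCombination, this, Fin.insertNth_self_removeNth]

lemma framePoint_injective : Function.Injective (K.framePoint a) := by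
  intro x y hxy
  rw [framePoint_eq_affineCombination, framePoint_eq_affineCombination] at hxy
  have := (affineIndependent_iff_eq_of_fintype_affineCombination_eq ℝ K.points).1 K.independent
    _ _ (sum_frameWeights a x) (sum_frameWeights a y) hxy
  exact ((Fin.insertNth_injective2 this).2)

lemma framePoint_mem_interior_iff : K.framePoint a x ∈ K.interior ↔
    1 - ∑ k, x k ∈ Set.Ioo (0 : ℝ) 1 ∧ ∀ k, x k ∈ Set.Ioo (0 : ℝ) 1 := by
  rw [framePoint_eq_affineCombination, affineCombination_mem_interior_iff (sum_frameWeights a x),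
    Fin.forall_iff_succAbove a]
  simp

lemma framePoint_mem_closedInterior_iff : K.framePoint a x ∈ K.closedInterior ↔
    1 - ∑ k, x k ∈ Set.Icc (0 : ℝ) 1 ∧ ∀ k, x k ∈ Set.Icc (0 : ℝ) 1 := by
  rw [framePoint_eq_affineCombination,
    affineCombination_mem_closedInterior_iff (sum_frameWeights a x), Fin.forall_iff_succAbove a]
  simp

lemma framePoint_mem_facet_self_iff [NeZero d] :
    K.framePoint a x ∈ affineSpan ℝ (Set.range (K.faceOpposite a).points) ↔ ∑ k, x k = 1 := by
  rw [framePoint_eq_affineCombination,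
    affineCombination_mem_affineSpan_faceOpposite_iff (sum_frameWeights a x)]
  rw [Fin.insertNth_apply_same, sub_eq_zero, eq_comm]

lemma framePoint_mem_facet_succAbove_iff [NeZero d] (k : Fin d) :
    K.framePoint a x ∈ affineSpan ℝ (Set.range (K.faceOpposite (a.succAbove k)).points) ↔
      x k = 0 := by
  rw [framePoint_eq_affineCombination,
    affineCombination_mem_affineSpan_faceOpposite_iff (sum_frameWeights a x)]
  simp

lemma point_sub_framePoint_self : K.points a - K.framePoint a x = -∑ k, x k • K.edge a k := by
  simp [framePoint]

lemma point_sub_framePoint_succAbove (k : Fin d) :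
    K.points (a.succAbove k) - K.framePoint a x = K.edge a k - ∑ k, x k • K.edge a k := by
  simp [framePoint, edge, sub_sub]

end Affine.Simplex

/-! ### The Gram matrix of a kite at its apex -/

namespace IsKite

open Affine.Simplex

variable {d : ℕ} {K : Affine.Simplex ℝ (EuclideanSpace ℝ (Fin d)) d} {a : Fin (d + 1)} {s t : ℝ}

lemma base_pos (hd : 2 ≤ d) (h : IsKite K a s t) : 0 < s := by
  have hne : a.succAbove ⟨0, by omega⟩ ≠ a.succAbove ⟨1, by omega⟩ := by simp
  rw [← h.1 _ _ (Fin.succAbove_ne _ _) (Fin.succAbove_ne _ _) hne, dist_pos]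
  exact K.independent.injective.ne hne

lemma leg_pos (hd : 2 ≤ d) (h : IsKite K a s t) : 0 < t := by
  rw [← h.2 _ (Fin.succAbove_ne a ⟨0, by omega⟩), dist_pos]
  exact K.independent.injective.ne (Fin.succAbove_ne _ _)

/-- The Gram matrix of the edge vectors at the apex of a kite has all its off-diagonal entries equal
to `t ^ 2 - s ^ 2 / 2`, by the law of cosines, and its diagonal entries exceed them by
`s ^ 2 / 2`. -/
lemma inner_edge (h : IsKite K a s t) (j k : Fin d) :
    ⟪K.edge a j, K.edge a k⟫ = (t ^ 2 - s ^ 2 / 2) + if j = k then s ^ 2 / 2 else 0 := by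
  have hn (k) : ‖K.edge a k‖ = t := by
    rw [edge, ← dist_eq_norm, h.2 _ (Fin.succAbove_ne _ _)]
  split_ifs with hjk
  · subst hjk
    rw [real_inner_self_eq_norm_sq, hn]; ring
  · have h1 := norm_sub_sq_real (K.edge a j) (K.edge a k)
    have h2 : ‖K.edge a j - K.edge a k‖ = s := by
      rw [edge, edge, sub_sub_sub_cancel_right, ← dist_eq_norm]
      exact h.1 _ _ (Fin.succAbove_ne _ _) (Fin.succAbove_ne _ _) (by simpa using hjk)
    rw [h2, hn, hn] at h1
    linarith

lemma inner_edge_sum (h : IsKite K a s t) (x : Fin d → ℝ) (j : Fin d) :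
    ⟪K.edge a j, ∑ k, x k • K.edge a k⟫ =
      (t ^ 2 - s ^ 2 / 2) * ∑ k, x k + s ^ 2 / 2 * x j := by
  simp only [inner_sum, inner_smul_right, h.inner_edge, mul_add, Finset.sum_add_distrib,
    ← Finset.sum_mul, mul_ite, mul_zero, Finset.sum_ite_eq, Finset.mem_univ, if_true]
  ring

lemma norm_sum_edge_sq (h : IsKite K a s t) (x : Fin d → ℝ) :
    ‖∑ k, x k • K.edge a k‖ ^ 2 =
      (t ^ 2 - s ^ 2 / 2) * (∑ k, x k) ^ 2 + s ^ 2 / 2 * ∑ k, x k ^ 2 := by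
  rw [← real_inner_self_eq_norm_sq, sum_inner]
  simp only [inner_smul_left, h.inner_edge_sum, RCLike.conj_to_real, mul_add,
    Finset.sum_add_distrib, ← Finset.sum_mul]
  rw [Finset.mul_sum _ _ (s ^ 2 / 2)]
  congr 1
  · ring
  · exact Finset.sum_congr rfl fun _ _ ↦ by ring

lemma dist_apex_framePoint_sq (h : IsKite K a s t) (x : Fin d → ℝ) :
    dist (K.points a) (K.framePoint a x) ^ 2 =
      (t ^ 2 - s ^ 2 / 2) * (∑ k, x k) ^ 2 + s ^ 2 / 2 * ∑ k, x k ^ 2 := by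
  rw [dist_eq_norm, point_sub_framePoint_self, norm_neg, h.norm_sum_edge_sq]

lemma dist_base_framePoint_sq (h : IsKite K a s t) (x : Fin d → ℝ) (j : Fin d) :
    dist (K.points (a.succAbove j)) (K.framePoint a x) ^ 2 =
      t ^ 2 - 2 * ((t ^ 2 - s ^ 2 / 2) * ∑ k, x k + s ^ 2 / 2 * x j) +
        ((t ^ 2 - s ^ 2 / 2) * (∑ k, x k) ^ 2 + s ^ 2 / 2 * ∑ k, x k ^ 2) := by
  rw [dist_eq_norm, point_sub_framePoint_succAbove, norm_sub_sq_real, h.norm_sum_edge_sq,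
    h.inner_edge_sum, ← real_inner_self_eq_norm_sq, h.inner_edge, if_pos rfl]
  ring

/-- The quantity is the eigenvalue of the Gram matrix at the apex for the all-ones vector. Up to a
factor `d`, it is the squared distance from the apex to the centroid of the base, and the apex is
not in the span of the base. -/
lemma gram_pos (hd : 2 ≤ d) (h : IsKite K a s t) : 0 < d * (t ^ 2 - s ^ 2 / 2) + s ^ 2 / 2 := by
  have hd' : (0 : ℝ) < d := by positivity
  have : NeZero d := ⟨by omega⟩
  have hne : K.points a ≠ K.framePoint a (fun _ ↦ (d : ℝ)⁻¹) := by
    intro he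
    apply K.points_notMem_affineSpan_faceOpposite a
    rw [he, framePoint_mem_facet_self_iff]
    simp [hd'.ne']
  have := dist_pos.2 hne
  have h2 := h.dist_apex_framePoint_sq (fun _ ↦ (d : ℝ)⁻¹)
  have h3 : 0 < dist (K.points a) (K.framePoint a (fun _ ↦ (d : ℝ)⁻¹)) ^ 2 := by positivity
  rw [h2] at h3
  simp only [Finset.sum_const, Finset.card_univ, Fintype.card_fin, nsmul_eq_mul,
    mul_inv_cancel₀ hd'.ne'] at h3
  have := mul_pos h3 hd'
  field_simp at this
  linarith

/-- The counterpart of `IsKite.gram_pos` for a facet through the apex, whose Gram matrix at the apex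
has the same entries in dimension `d - 1`. -/
lemma lateral_gram_pos (hd : 2 ≤ d) (h : IsKite K a s t) :
    0 < (d - 1) * (t ^ 2 - s ^ 2 / 2) + s ^ 2 / 2 := by
  have h1 := h.gram_pos hd
  have hd' : (2 : ℝ) ≤ d := by exact_mod_cast hd
  have hs : 0 < s ^ 2 := pow_pos (h.base_pos hd) 2
  rcases le_or_gt 0 (t ^ 2 - s ^ 2 / 2) with hc | hc
  · have : 0 ≤ (d - 1) * (t ^ 2 - s ^ 2 / 2) := mul_nonneg (by linarith) hc
    linarith
  · linarith

end IsKite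

/-! ### Centers, radii and heights of a kite -/

lemma sum_ite_eq_zero_else {d : ℕ} (k : Fin d) (c : ℝ) :
    ∑ j, (if j = k then 0 else c) = (d - 1) * c := by
  have : ∀ j : Fin d, (if j = k then 0 else c) = c - if j = k then c else 0 := by
    intro j; split_ifs <;> simp
  simp only [this, Finset.sum_sub_distrib]
  simp
  ring

namespace IsKite

open Affine.Simplex

variable {d : ℕ} {K : Affine.Simplex ℝ (EuclideanSpace ℝ (Fin d)) d} {a : Fin (d + 1)} {s t : ℝ}

/-- The all-ones eigenvalue of the Gram matrix in terms of the eccentricity `t / s`. -/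
lemma gram_eq (hs : s ≠ 0) : d * (t ^ 2 - s ^ 2 / 2) + s ^ 2 / 2 =
    s ^ 2 / 2 * (2 * (t / s) ^ 2 * d - (d - 1)) := by
  field_simp
  ring

lemma lateral_gram_eq (hs : s ≠ 0) : ((d : ℝ) - 1) * (t ^ 2 - s ^ 2 / 2) + s ^ 2 / 2 =
    s ^ 2 / 2 * (2 * (t / s) ^ 2 * (d - 1) - (d - 2)) := by
  field_simp
  ring

lemma discr_pos (hd : 2 ≤ d) (h : IsKite K a s t) : 0 < 2 * (t / s) ^ 2 * d - (d - 1) := by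
  have hs := h.base_pos hd
  have := h.gram_pos hd
  rw [gram_eq hs.ne'] at this
  exact (mul_pos_iff_of_pos_left (by positivity)).1 this

lemma lateral_discr_pos (hd : 2 ≤ d) (h : IsKite K a s t) :
    0 < 2 * (t / s) ^ 2 * (d - 1) - (d - 2) := by
  have hs := h.base_pos hd
  have := h.lateral_gram_pos hd
  rw [lateral_gram_eq hs.ne'] at this
  exact (mul_pos_iff_of_pos_left (by positivity)).1 this

/-- The circumcenter lies on the axis of the kite, so its coordinates at the apex are all equal; the
value is forced by equidistance from the apex and the base. -/
lemma circumcenter_eq (hd : 2 ≤ d) (h : IsKite K a s t) : K.circumcenter =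
      K.framePoint a (fun _ ↦ t ^ 2 / (2 * (d * (t ^ 2 - s ^ 2 / 2) + s ^ 2 / 2))) ∧
    K.circumradius ^ 2 = d * t ^ 4 / (4 * (d * (t ^ 2 - s ^ 2 / 2) + s ^ 2 / 2)) := by
  have hg := h.gram_pos hd
  set μ := t ^ 2 / (2 * (d * (t ^ 2 - s ^ 2 / 2) + s ^ 2 / 2)) with hμ
  have hμ' : t ^ 2 = 2 * μ * (d * (t ^ 2 - s ^ 2 / 2) + s ^ 2 / 2) := by
    rw [hμ]
    generalize d * (t ^ 2 - s ^ 2 / 2) + s ^ 2 / 2 = G at hg ⊢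
    field_simp
  have ha := h.dist_apex_framePoint_sq (fun _ ↦ μ)
  simp only [Finset.sum_const, Finset.card_univ, Fintype.card_fin, nsmul_eq_mul] at ha
  have hb : ∀ i, dist (K.points i) (K.framePoint a (fun _ ↦ μ)) =
      dist (K.points a) (K.framePoint a (fun _ ↦ μ)) := by
    rw [Fin.forall_iff_succAbove a]
    refine ⟨rfl, fun j ↦ ?_⟩
    rw [← sq_eq_sq₀ dist_nonneg dist_nonneg, ha, h.dist_base_framePoint_sq]
    simp only [Finset.sum_const, Finset.card_univ, Fintype.card_fin, nsmul_eq_mul]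
    linear_combination hμ'
  have hm : K.framePoint a (fun _ ↦ μ) ∈ affineSpan ℝ (Set.range K.points) := by
    simp [K.affineSpan_range_eq_top]
  refine ⟨(K.eq_circumcenter_of_dist_eq hm hb).symm, ?_⟩
  rw [← K.eq_circumradius_of_dist_eq hm hb, ha, hμ]
  field_simp
  ring

lemma circumcenter_mem_interior_iff (hd : 2 ≤ d) (h : IsKite K a s t) :
    K.circumcenter ∈ K.interior ↔ ((d : ℝ) - 1) / d < (t / s) ^ 2 := by
  have hg := h.gram_pos hd
  have hs := h.base_pos hd
  have ht := h.leg_pos hd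
  have hd' : (2 : ℝ) ≤ d := by exact_mod_cast hd
  rw [(h.circumcenter_eq hd).1, framePoint_mem_interior_iff]
  set μ := t ^ 2 / (2 * (d * (t ^ 2 - s ^ 2 / 2) + s ^ 2 / 2)) with hμ
  have hμ0 : 0 < μ := by positivity
  simp only [Finset.sum_const, Finset.card_univ, Fintype.card_fin, nsmul_eq_mul, Set.mem_Ioo]
  have h1 : ((d : ℝ) - 1) / d < (t / s) ^ 2 ↔ d * μ < 1 := by
    rw [hμ, ← mul_div_assoc, div_lt_one (by positivity), div_pow,
      div_lt_div_iff₀ (by positivity) (by positivity)]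
    constructor <;> intro h <;> linarith
  rw [h1]
  constructor
  · rintro ⟨h, -⟩; linarith
  · intro h
    have : 0 < d * μ := by positivity
    refine ⟨⟨by linarith, by linarith⟩, fun _ ↦ ⟨hμ0, ?_⟩⟩
    nlinarith

lemma circumradius_eq (hd : 2 ≤ d) (h : IsKite K a s t) : K.circumradius =
    √((d : ℝ) / (2 * (2 * (t / s) ^ 2 * d - (d - 1)))) * (t / s) ^ 2 * s := by
  have hs := h.base_pos hd
  have hD := h.discr_pos hd
  rw [← sq_eq_sq₀ K.circumradius_nonneg (by positivity), (h.circumcenter_eq hd).2,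
    gram_eq hs.ne', mul_pow, mul_pow, Real.sq_sqrt (by positivity)]
  set D := 2 * (t / s) ^ 2 * d - (d - 1)
  field_simp
  ring

lemma height_apex_eq [NeZero d] (hd : 2 ≤ d) (h : IsKite K a s t) :
    K.height a = √((2 * (t / s) ^ 2 * d - (d - 1)) / (2 * d)) * s := by
  have hs := h.base_pos hd
  have hD := h.discr_pos hd
  have hd' : (0 : ℝ) < d := by positivity
  have hsum : ∑ _k : Fin d, (d : ℝ)⁻¹ = 1 := by simp [hd'.ne']
  rw [K.height_eq_dist_of_inner_eq_zero (p := K.framePoint a (fun _ ↦ (d : ℝ)⁻¹))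
    ((framePoint_mem_facet_self_iff ..).2 hsum)]
  · rw [← sq_eq_sq₀ dist_nonneg (by positivity), h.dist_apex_framePoint_sq, hsum, mul_pow,
      Real.sq_sqrt (by positivity)]
    have := gram_eq (d := d) (t := t) hs.ne'
    simp only [Finset.sum_const, Finset.card_univ, Fintype.card_fin, nsmul_eq_mul]
    set D := 2 * (t / s) ^ 2 * d - (d - 1)
    field_simp
    linear_combination 2 * this
  · intro j hj
    obtain ⟨k, rfl⟩ := Fin.exists_succAbove_eq hj
    rw [vsub_eq_sub, vsub_eq_sub, point_sub_framePoint_self, point_sub_framePoint_succAbove,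
      inner_neg_right, inner_sub_left, h.inner_edge_sum, real_inner_self_eq_norm_sq,
      h.norm_sum_edge_sq, hsum]
    simp only [Finset.sum_const, Finset.card_univ, Fintype.card_fin, nsmul_eq_mul]
    field_simp
    ring

/-- The foot of the altitude from the base vertex `k` has coordinate `0` at `k` and, by symmetry, a
common coordinate `l` at the other base vertices; the value of `l` is forced by orthogonality to the
edges at the apex. -/
lemma height_base_eq [NeZero d] (hd : 2 ≤ d) (h : IsKite K a s t) (k : Fin d) :
    K.height (a.succAbove k) = √((2 * (t / s) ^ 2 * d - (d - 1)) /
      (2 * (2 * (t / s) ^ 2 * (d - 1) - (d - 2)))) * s := by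
  have hs := h.base_pos hd
  have hD := h.discr_pos hd
  have hE := h.lateral_discr_pos hd
  have hg := h.lateral_gram_pos hd
  obtain ⟨l, hl⟩ : ∃ l, (t ^ 2 - s ^ 2 / 2) =
      l * ((d - 1) * (t ^ 2 - s ^ 2 / 2) + s ^ 2 / 2) :=
    ⟨(t ^ 2 - s ^ 2 / 2) / ((d - 1) * (t ^ 2 - s ^ 2 / 2) + s ^ 2 / 2),
      (div_mul_cancel₀ _ hg.ne').symm⟩
  have hsq : ∀ j, (if j = k then 0 else l) ^ 2 = if j = k then 0 else l ^ 2 := by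
    intro j; split_ifs <;> simp
  rw [K.height_eq_dist_of_inner_eq_zero (p := K.framePoint a (fun j ↦ if j = k then 0 else l))
    ((framePoint_mem_facet_succAbove_iff ..).2 (by simp))]
  · rw [← sq_eq_sq₀ dist_nonneg (by positivity), h.dist_base_framePoint_sq, mul_pow,
      Real.sq_sqrt (by positivity)]
    simp only [hsq, sum_ite_eq_zero_else, if_true]
    have e1 := gram_eq (d := d) (t := t) hs.ne'
    have e2 := lateral_gram_eq (d := d) (t := t) hs.ne'
    set D := 2 * (t / s) ^ 2 * d - (d - 1)
    set E := 2 * (t / s) ^ 2 * (d - 1) - (d - 2)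
    have e3 : D / (2 * E) * s ^ 2 * ((d - 1) * (t ^ 2 - s ^ 2 / 2) + s ^ 2 / 2) =
        s ^ 2 / 2 * (d * (t ^ 2 - s ^ 2 / 2) + s ^ 2 / 2) := by
      rw [e1, e2]; field_simp
    apply mul_right_cancel₀ hg.ne'
    linear_combination ((d - 1) * ((t ^ 2 - s ^ 2 / 2) -
      l * ((d - 1) * (t ^ 2 - s ^ 2 / 2) + s ^ 2 / 2))) * hl - e3
  · rw [Fin.forall_iff_succAbove a]
    constructor
    · intro _
      rw [vsub_eq_sub, vsub_eq_sub, point_sub_framePoint_self, point_sub_framePoint_succAbove,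
        inner_neg_left, inner_sub_right, real_inner_comm, h.inner_edge_sum,
        real_inner_self_eq_norm_sq, h.norm_sum_edge_sq]
      simp only [hsq, sum_ite_eq_zero_else, if_true]
      linear_combination (-(d - 1) * l) * hl
    · intro j hj
      have hjk : j ≠ k := fun e ↦ hj (by rw [e])
      rw [vsub_eq_sub, vsub_eq_sub, point_sub_framePoint_succAbove, point_sub_framePoint_succAbove,
        inner_sub_left, inner_sub_right, inner_sub_right, h.inner_edge, if_neg hjk,
        real_inner_comm (K.edge a k), h.inner_edge_sum, h.inner_edge_sum,
        real_inner_self_eq_norm_sq, h.norm_sum_edge_sq]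
      simp only [hsq, sum_ite_eq_zero_else, if_true, if_neg hjk]
      linear_combination (1 - (d - 1) * l) * hl

/-- The reciprocal of the inradius of a simplex is the sum of the reciprocals of its heights. -/
lemma inradius_eq [NeZero d] (hd : 2 ≤ d) (h : IsKite K a s t) : K.inradius =
    √(2 * (t / s) ^ 2 * d - (d - 1)) /
      (√2 * (√(d : ℝ) + d * √(2 * (t / s) ^ 2 * (d - 1) - (d - 2)))) * s := by
  have hs := h.base_pos hd
  have hD := h.discr_pos hd
  have hE := h.lateral_discr_pos hd
  rw [K.inradius_eq_abs_inv_sum]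
  simp only [excenterWeightsUnnorm_empty_apply]
  rw [Fin.sum_univ_succAbove _ a, h.height_apex_eq hd]
  simp only [h.height_base_eq hd]
  set D := 2 * (t / s) ^ 2 * d - (d - 1)
  set E := 2 * (t / s) ^ 2 * (d - 1) - (d - 2)
  rw [abs_of_nonneg (by positivity), Real.sqrt_div hD.le, Real.sqrt_div hD.le,
    Real.sqrt_mul (by norm_num), Real.sqrt_mul (by norm_num)]
  simp only [Finset.sum_const, Finset.card_univ, Fintype.card_fin, nsmul_eq_mul]
  have : 0 < √D := Real.sqrt_pos.2 hD
  have : 0 < √E := Real.sqrt_pos.2 hE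
  have : (0 : ℝ) < √d := Real.sqrt_pos.2 (by positivity)
  field_simp

/-- The base is a regular simplex, so its circumcenter is its centroid. -/
lemma circumradius_base_sq [NeZero d] (hd : 2 ≤ d) (h : IsKite K a s t) :
    (K.faceOpposite a).circumradius ^ 2 = s ^ 2 / 2 * ((d - 1) / d) := by
  have hd' : (0 : ℝ) < d := by positivity
  have hsum : ∑ _k : Fin d, (d : ℝ)⁻¹ = 1 := by simp [hd'.ne']
  have key : ∀ j, j ≠ a → dist (K.points j) (K.framePoint a (fun _ ↦ (d : ℝ)⁻¹)) =
      √(s ^ 2 / 2 * ((d - 1) / d)) := by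
    intro j hj
    obtain ⟨k, rfl⟩ := Fin.exists_succAbove_eq hj
    rw [eq_comm, Real.sqrt_eq_iff_eq_sq _ dist_nonneg, h.dist_base_framePoint_sq, hsum]
    · simp only [Finset.sum_const, Finset.card_univ, Fintype.card_fin, nsmul_eq_mul]
      field_simp
      ring
    · have : (1 : ℝ) ≤ d := by exact_mod_cast (by omega : 1 ≤ d)
      exact mul_nonneg (by positivity) (div_nonneg (by linarith) hd'.le)
  rw [K.circumradius_faceOpposite_eq ((framePoint_mem_facet_self_iff ..).2 hsum) key,
    Real.sq_sqrt]
  have : (1 : ℝ) ≤ d := by exact_mod_cast (by omega : 1 ≤ d)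
  exact mul_nonneg (by positivity) (div_nonneg (by linarith) hd'.le)

/-- A facet through the apex has a Gram matrix with the same entries in dimension `d - 1`, so this
is the formula of `IsKite.circumcenter_eq` with `d - 1` in place of `d`. -/
lemma circumradius_lateral_sq [NeZero d] (hd : 2 ≤ d) (h : IsKite K a s t) (k : Fin d) :
    (K.faceOpposite (a.succAbove k)).circumradius ^ 2 =
      (d - 1) * t ^ 4 / (4 * ((d - 1) * (t ^ 2 - s ^ 2 / 2) + s ^ 2 / 2)) := by
  have hg := h.lateral_gram_pos hd
  set μ := t ^ 2 / (2 * ((d - 1) * (t ^ 2 - s ^ 2 / 2) + s ^ 2 / 2)) with hμ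
  have hμ' : t ^ 2 = 2 * μ * ((d - 1) * (t ^ 2 - s ^ 2 / 2) + s ^ 2 / 2) := by
    rw [hμ]
    generalize (d - 1) * (t ^ 2 - s ^ 2 / 2) + s ^ 2 / 2 = G at hg ⊢
    field_simp
  have hsq : ∀ j, (if j = k then 0 else μ) ^ 2 = if j = k then 0 else μ ^ 2 := by
    intro j; split_ifs <;> simp
  have ha := h.dist_apex_framePoint_sq (fun j ↦ if j = k then 0 else μ)
  simp only [hsq, sum_ite_eq_zero_else] at ha
  have hb : ∀ i, i ≠ a.succAbove k →
      dist (K.points i) (K.framePoint a (fun j ↦ if j = k then 0 else μ)) =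
        dist (K.points a) (K.framePoint a (fun j ↦ if j = k then 0 else μ)) := by
    rw [Fin.forall_iff_succAbove a]
    refine ⟨fun _ ↦ rfl, fun j hj ↦ ?_⟩
    have hjk : j ≠ k := fun e ↦ hj (by rw [e])
    rw [← sq_eq_sq₀ dist_nonneg dist_nonneg, ha, h.dist_base_framePoint_sq]
    simp only [hsq, sum_ite_eq_zero_else, if_neg hjk]
    linear_combination hμ'
  rw [K.circumradius_faceOpposite_eq ((framePoint_mem_facet_succAbove_iff ..).2 (by simp)) hb, ha,
    hμ]
  field_simp
  ring

/-- The lateral facets have equal circumradii, so only the base and one lateral facet have to be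
compared; their squared circumradii agree exactly when
`(d * t ^ 2 - (d - 2) * s ^ 2) * (t ^ 2 - s ^ 2)` vanishes. -/
lemma isEquiradial_iff [NeZero d] (hd : 2 ≤ d) (h : IsKite K a s t) :
    IsEquiradial K ↔ (t / s) ^ 2 = ((d : ℝ) - 2) / d ∨ t / s = 1 := by
  have hs := h.base_pos hd
  have ht := h.leg_pos hd
  have hg := h.lateral_gram_pos hd
  have hd' : (2 : ℝ) ≤ d := by exact_mod_cast hd
  have h1 : IsEquiradial K ↔ s ^ 2 / 2 * ((d - 1) / d) =
      (d - 1) * t ^ 4 / (4 * ((d - 1) * (t ^ 2 - s ^ 2 / 2) + s ^ 2 / 2)) := by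
    constructor
    · intro he
      rw [← h.circumradius_base_sq hd, ← h.circumradius_lateral_sq hd ⟨0, by omega⟩, he]
    · intro he
      have key : ∀ i, (K.faceOpposite i).circumradius = (K.faceOpposite a).circumradius := by
        rw [Fin.forall_iff_succAbove a]
        refine ⟨rfl, fun k ↦ ?_⟩
        rw [← sq_eq_sq₀ (circumradius_nonneg _) (circumradius_nonneg _),
          h.circumradius_base_sq hd, h.circumradius_lateral_sq hd, he]
      intro i j
      rw [key i, key j]
  have h2 : t / s = 1 ↔ t ^ 2 - s ^ 2 = 0 := by
    rw [div_eq_one_iff_eq hs.ne', sub_eq_zero, sq_eq_sq₀ ht.le hs.le]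
  have h3 : (t / s) ^ 2 = ((d : ℝ) - 2) / d ↔ d * t ^ 2 - (d - 2) * s ^ 2 = 0 := by
    rw [div_pow, div_eq_div_iff (by positivity) (by positivity), sub_eq_zero, mul_comm (t ^ 2)]
  rw [h1, h2, h3, ← mul_eq_zero, ← mul_div_assoc,
    div_eq_div_iff (by positivity) (by positivity), ← sub_eq_zero]
  have h4 : s ^ 2 / 2 * ((d : ℝ) - 1) * (4 * ((d - 1) * (t ^ 2 - s ^ 2 / 2) + s ^ 2 / 2)) -
      (d - 1) * t ^ 4 * d = -(d - 1) * ((d * t ^ 2 - (d - 2) * s ^ 2) * (t ^ 2 - s ^ 2)) := by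
    ring
  rw [h4, mul_eq_zero, or_iff_right]
  linarith

/-- All edge vectors at the apex have the same pairwise inner product, so a kite is orthocentric;
its orthocenter lies on the axis. -/
lemma existsUnique_orthocenter (hd : 2 ≤ d) (h : IsKite K a s t) :
    ∃ H, (∀ X, IsOrthocenter K X ↔ X = H) ∧ (H ∈ K.interior ↔ 1 / 2 < (t / s) ^ 2) := by
  have hs := h.base_pos hd
  have hg := h.gram_pos hd
  have hd' : (2 : ℝ) ≤ d := by exact_mod_cast hd
  set ν := (t ^ 2 - s ^ 2 / 2) / (d * (t ^ 2 - s ^ 2 / 2) + s ^ 2 / 2) with hν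
  have hν' : ν * (d * (t ^ 2 - s ^ 2 / 2) + s ^ 2 / 2) = t ^ 2 - s ^ 2 / 2 := by
    rw [hν, div_mul_cancel₀ _ hg.ne']
  have hH : IsOrthocenter K (K.framePoint a fun _ ↦ ν) := by
    -- `ν` makes the vector from the point to a base vertex orthogonal to all other edges at the
    -- apex
    have e1 : ∀ j k, ⟪K.edge a j, K.edge a k - ∑ l, ν • K.edge a l⟫ =
        if j = k then s ^ 2 / 2 else 0 := by
      intro j k
      rw [inner_sub_right, h.inner_edge, h.inner_edge_sum _ j]
      simp only [Finset.sum_const, Finset.card_univ, Fintype.card_fin, nsmul_eq_mul]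
      linear_combination -hν'
    have e2 : ∀ j, ⟪K.edge a j, ∑ l, ν • K.edge a l⟫ = t ^ 2 - s ^ 2 / 2 := by
      intro j
      rw [h.inner_edge_sum _ j]
      simp only [Finset.sum_const, Finset.card_univ, Fintype.card_fin, nsmul_eq_mul]
      linear_combination hν'
    -- the right-hand side does not depend on `j` among the vertices of the facet opposite to `i`
    have e3 : ∀ i j, j ≠ i →
        ⟪K.points j - K.points a, K.framePoint a (fun _ ↦ ν) - K.points i⟫ =
          if i = a then t ^ 2 - s ^ 2 / 2 else 0 := by
      intro i j hji
      rcases Fin.eq_self_or_eq_succAbove a j with rfl | ⟨j, rfl⟩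
      · simp [hji.symm]
      rw [← neg_sub (K.points i), inner_neg_right, ← edge]
      rcases Fin.eq_self_or_eq_succAbove a i with rfl | ⟨k, rfl⟩
      · rw [point_sub_framePoint_self, inner_neg_right, e2, if_pos rfl, neg_neg]
      · have : j ≠ k := fun e ↦ hji (by rw [e])
        rw [point_sub_framePoint_succAbove, e1, if_neg this, if_neg (Fin.succAbove_ne _ _),
          neg_zero]
    intro i
    rw [mem_altitude_iff_inner _ _ (by simp [K.affineSpan_range_eq_top])]
    intro j k hj hk
    rw [vsub_eq_sub, vsub_eq_sub, ← sub_sub_sub_cancel_right _ _ (K.points a), inner_sub_left,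
      e3 i j hj, e3 i k hk, sub_self]
  refine ⟨_, fun X ↦ ⟨fun hX ↦ hX.eq hd hH, fun e ↦ e ▸ hH⟩, ?_⟩
  rw [framePoint_mem_interior_iff]
  simp only [Finset.sum_const, Finset.card_univ, Fintype.card_fin, nsmul_eq_mul, Set.mem_Ioo]
  have h1 : 1 / 2 < (t / s) ^ 2 ↔ 0 < ν := by
    rw [hν, div_pos_iff_of_pos_right hg, div_pow, div_lt_div_iff₀ (by norm_num) (by positivity)]
    constructor <;> intro h <;> linarith
  have h2 : d * ν < 1 := by
    rw [hν, ← mul_div_assoc, div_lt_one hg]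
    linarith [pow_pos hs 2]
  rw [h1]
  constructor
  · rintro ⟨-, h⟩
    exact (h ⟨0, by omega⟩).1
  · intro h
    have : 0 < d * ν := by positivity
    refine ⟨⟨by linarith, by linarith⟩, fun _ ↦ ⟨h, ?_⟩⟩
    nlinarith

end IsKite

/-! ### The volume of a simplex -/

section Volume

open MeasureTheory

/-- The volume of the corner cut off from the positive orthant by `∑ i, x i ≤ r`. -/
lemma volume_corner_simplex (n : ℕ) {r : ℝ} (hr : 0 ≤ r) :
    volume {x : Fin n → ℝ | (∀ i, 0 ≤ x i) ∧ ∑ i, x i ≤ r} =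
      ENNReal.ofReal (r ^ n / n.factorial) := by
  induction n generalizing r with
  | zero => simp [hr, volume_pi]
  | succ n ih =>
    have hmeas : MeasurableSet {x : Fin (n + 1) → ℝ | (∀ i, 0 ≤ x i) ∧ ∑ i, x i ≤ r} := by
      measurability
    have hmp := (volume_preserving_piFinSuccAbove (fun _ : Fin (n + 1) ↦ ℝ) 0).symm
    rw [← hmp.measure_preimage hmeas.nullMeasurableSet, Measure.volume_eq_prod,
      Measure.prod_apply ((MeasurableEquiv.measurable _) hmeas)]
    -- the slice at first coordinate `u` is the corner of size `r - u`, one dimension lower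
    have hslice : ∀ u : ℝ, volume (Prod.mk u ⁻¹'
        ((MeasurableEquiv.piFinSuccAbove (fun _ : Fin (n + 1) ↦ ℝ) 0).symm ⁻¹'
          {x : Fin (n + 1) → ℝ | (∀ i, 0 ≤ x i) ∧ ∑ i, x i ≤ r})) =
        (Set.Icc 0 r).indicator
          (fun u ↦ ENNReal.ofReal ((r - u) ^ n / n.factorial)) u := by
      intro u
      have hpre : (Prod.mk u ⁻¹'
          ((MeasurableEquiv.piFinSuccAbove (fun _ : Fin (n + 1) ↦ ℝ) 0).symm ⁻¹'
            {x : Fin (n + 1) → ℝ | (∀ i, 0 ≤ x i) ∧ ∑ i, x i ≤ r})) =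
          {y : Fin n → ℝ | 0 ≤ u ∧ (∀ i, 0 ≤ y i) ∧ u + ∑ i, y i ≤ r} := by
        ext y
        simp [MeasurableEquiv.piFinSuccAbove, Fin.forall_fin_succ, Fin.sum_univ_succ, and_assoc]
      rw [hpre]
      by_cases hu : u ∈ Set.Icc 0 r
      · rw [Set.indicator_of_mem hu, ← ih (sub_nonneg.2 hu.2)]
        congr 1
        ext y
        simp [hu.1, le_sub_iff_add_le']
      · rw [Set.indicator_of_notMem hu]
        convert measure_empty (μ := (volume : Measure (Fin n → ℝ)))
        ext y
        simp only [Set.mem_ofPred_eq, Set.mem_empty_iff_false, iff_false]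
        rintro ⟨h0, h1, h2⟩
        exact hu ⟨h0, by linarith [Finset.sum_nonneg fun i (_ : i ∈ Finset.univ) ↦ h1 i]⟩
    simp_rw [hslice]
    rw [lintegral_indicator measurableSet_Icc, ← ofReal_integral_eq_lintegral_ofReal,
      integral_Icc_eq_integral_Ioc, ← intervalIntegral.integral_of_le hr]
    · congr 1
      rw [intervalIntegral.integral_div,
        intervalIntegral.integral_comp_sub_left (fun u : ℝ ↦ u ^ n) r, integral_pow]
      simp [Nat.factorial_succ]
      field_simp
    · exact (Continuous.continuousOn (by fun_prop)).integrableOn_compact isCompact_Icc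
    · filter_upwards [ae_restrict_mem measurableSet_Icc] with u hu
      have := sub_nonneg.2 hu.2
      positivity

/-- The volume of a simplex is the volume of the corner simplex times the absolute
determinant of its edge vectors at a vertex, which is the square root of their Gram determinant. -/
lemma Affine.Simplex.volume_convexHull {d : ℕ}
    (K : Affine.Simplex ℝ (EuclideanSpace ℝ (Fin d)) d) (a : Fin (d + 1)) :
    volume (convexHull ℝ (Set.range K.points)) =
      ENNReal.ofReal (1 / (d.factorial : ℝ) *
        √(Matrix.gram ℝ (K.edge a)).det) := by
  let M : Matrix (Fin d) (Fin d) ℝ := Matrix.of fun i k ↦ K.edge a k i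
  have hgram : (Matrix.gram ℝ (K.edge a)).det = M.det ^ 2 := by
    have : Matrix.gram ℝ (K.edge a) = M.transpose * M := by
      ext j k
      simp [M, Matrix.gram_apply, Matrix.mul_apply, PiLp.inner_apply, mul_comm]
    rw [this, Matrix.det_mul, Matrix.det_transpose, pow_two]
  have hset : (MeasurableEquiv.toLp 2 (Fin d → ℝ)) ⁻¹' convexHull ℝ (Set.range K.points) =
      (fun y : Fin d → ℝ ↦ (K.points a).ofLp + y) '' (Matrix.toLin' M ''
        {x : Fin d → ℝ | (∀ i, 0 ≤ x i) ∧ ∑ i, x i ≤ 1}) := by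
    have hfp (x : Fin d → ℝ) :
        K.framePoint a x = WithLp.toLp 2 ((K.points a).ofLp + Matrix.toLin' M x) := by
      ext i
      simp [Affine.Simplex.framePoint, M, Matrix.mulVec, dotProduct, mul_comm]
    ext y
    obtain ⟨x, hx⟩ := K.exists_eq_framePoint a (WithLp.toLp 2 y)
    have hmem : K.framePoint a x ∈ K.closedInterior ↔ (∀ i, 0 ≤ x i) ∧ ∑ i, x i ≤ 1 := by
      rw [K.framePoint_mem_closedInterior_iff]
      constructor
      · rintro ⟨h1, h2⟩
        exact ⟨fun i ↦ (h2 i).1, by linarith [h1.1]⟩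
      · rintro ⟨h1, h2⟩
        exact ⟨⟨by linarith, by linarith [Finset.sum_nonneg fun i (_ : i ∈ Finset.univ) ↦ h1 i]⟩,
          fun i ↦ ⟨h1 i, (Finset.single_le_sum (fun j _ ↦ h1 j) (Finset.mem_univ i)).trans h2⟩⟩
    change WithLp.toLp 2 y ∈ convexHull ℝ (Set.range K.points) ↔ _
    rw [convexHull_eq_closedInterior, hx, hmem]
    have hinj : Function.Injective fun x ↦ (K.points a).ofLp + Matrix.toLin' M x := by
      intro x x' hxx
      have : K.framePoint a x = K.framePoint a x' := by
        rw [hfp, hfp]; exact congrArg _ hxx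
      simpa using K.framePoint_injective a this
    have hy : y = (K.points a).ofLp + Matrix.toLin' M x := by
      rw [hfp] at hx
      exact WithLp.toLp_injective 2 hx
    rw [Set.image_image, hy, hinj.mem_set_image]
    rfl
  have hmp : MeasurePreserving (MeasurableEquiv.toLp 2 (Fin d → ℝ)) volume volume :=
    PiLp.volume_preserving_toLp (Fin d)
  rw [← hmp.measure_preimage_equiv, hset, Set.image_add_left, measure_preimage_add,
    Measure.addHaar_image_linearMap, volume_corner_simplex d zero_le_one, LinearMap.det_toLin',
    ← ENNReal.ofReal_mul (abs_nonneg _), hgram, Real.sqrt_sq_eq_abs, one_pow, mul_comm]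

end Volume

/-- The Gram matrix at the apex is a rank-one perturbation of a scalar matrix, so the matrix
determinant lemma evaluates its determinant. -/
lemma IsKite.volume_eq {d : ℕ} {K : Affine.Simplex ℝ (EuclideanSpace ℝ (Fin d)) d}
    {a : Fin (d + 1)} {s t : ℝ} (hd : 2 ≤ d) (h : IsKite K a s t) :
    MeasureTheory.volume (convexHull ℝ (Set.range K.points)) = ENNReal.ofReal
      (1 / (d.factorial : ℝ) * √((2 * (t / s) ^ 2 * d - (d - 1)) / 2 ^ d) * s ^ d) := by
  have hs := h.base_pos hd
  have hD := h.discr_pos hd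
  have hG : Matrix.gram ℝ (K.edge a) = (s ^ 2 / 2) •
      (1 + Matrix.replicateCol Unit (fun _ : Fin d ↦ (t ^ 2 - s ^ 2 / 2) / (s ^ 2 / 2)) *
        Matrix.replicateRow Unit (fun _ : Fin d ↦ (1 : ℝ))) := by
    ext j k
    rw [Matrix.gram_apply, h.inner_edge, Matrix.smul_apply, Matrix.add_apply, Matrix.one_apply]
    split_ifs
    · simp [Matrix.mul_apply]
      field_simp
      ring
    · simp [Matrix.mul_apply]
      field_simp
  have hdet : (Matrix.gram ℝ (K.edge a)).det =
      (2 * (t / s) ^ 2 * d - (d - 1)) / 2 ^ d * (s ^ d) ^ 2 := by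
    rw [hG, Matrix.det_smul, Matrix.det_one_add_replicateCol_mul_replicateRow]
    simp only [dotProduct, one_mul, Finset.sum_const, Finset.card_univ, Fintype.card_fin,
      nsmul_eq_mul, div_pow]
    field_simp
    ring
  rw [K.volume_convexHull a, hdet, Real.sqrt_mul (by positivity), Real.sqrt_sq (by positivity),
    ← mul_assoc]

/-! ### Kites with prescribed eccentricity -/

/-- Adding a multiple of the all-ones vector to the standard basis vectors gives, for any `c` above
`-1 / d`, vectors whose Gram matrix has `1 + c` on the diagonal and `c` elsewhere. Together with the
origin as apex they are the vertices of a kite. -/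
lemma exists_isKite {d : ℕ} (hd : 2 ≤ d) {c : ℝ} (hc : 0 < 1 + d * c) :
    ∃ K : Affine.Simplex ℝ (EuclideanSpace ℝ (Fin d)) d, IsKite K 0 (√2) (√(1 + c)) := by
  have hd' : (0 : ℝ) < d := by positivity
  -- `b` solves `2 * b + d * b ^ 2 = c`
  obtain ⟨b, hb⟩ : ∃ b : ℝ, 2 * b + d * b ^ 2 = c := by
    refine ⟨(-1 + √(1 + d * c)) / d, ?_⟩
    have := Real.sq_sqrt hc.le
    field_simp
    linear_combination this
  let v : Fin d → EuclideanSpace ℝ (Fin d) := fun k ↦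
    EuclideanSpace.single k 1 + WithLp.toLp 2 (fun _ ↦ b)
  have hv : ∀ j k, ⟪v j, v k⟫ = c + if j = k then 1 else 0 := by
    intro j k
    simp only [v, PiLp.inner_apply, PiLp.add_apply, PiLp.single_apply]
    simp [add_mul, mul_add, Finset.sum_add_distrib, ← hb]
    ring
  have hli : LinearIndependent ℝ v := by
    rw [Fintype.linearIndependent_iff]
    intro g hg
    have h1 : ∀ j, c * ∑ k, g k + g j = 0 := by
      intro j
      have := congrArg (fun w ↦ ⟪v j, w⟫) hg
      simp only [inner_sum, inner_smul_right, hv, mul_add, Finset.sum_add_distrib,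
        ← Finset.sum_mul, inner_zero_right] at this
      simpa [mul_comm] using this
    have h2 : (1 + d * c) * ∑ k, g k = 0 := by
      have := Finset.sum_congr rfl fun j (_ : j ∈ Finset.univ) ↦ h1 j
      simp only [Finset.sum_add_distrib, Finset.sum_const, Finset.card_univ, Fintype.card_fin,
        nsmul_eq_mul, smul_zero] at this
      linear_combination this
    have h3 := (mul_eq_zero.1 h2).resolve_left hc.ne'
    intro j
    simpa [h3] using h1 j
  have hai : AffineIndependent ℝ (Fin.cons 0 v : Fin (d + 1) → EuclideanSpace ℝ (Fin d)) := by
    rw [affineIndependent_iff_linearIndependent_vsub ℝ _ (0 : Fin (d + 1)),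
      ← linearIndependent_equiv (finSuccAboveEquiv (0 : Fin (d + 1)))]
    have hcomp : (fun i : {i : Fin (d + 1) // i ≠ 0} ↦
        (Fin.cons 0 v : Fin (d + 1) → EuclideanSpace ℝ (Fin d)) i -ᵥ
          (Fin.cons 0 v : Fin (d + 1) → EuclideanSpace ℝ (Fin d)) 0) ∘
          finSuccAboveEquiv (0 : Fin (d + 1)) = v := by
      ext k : 1
      simp [finSuccAboveEquiv]
    rw [hcomp]
    exact hli
  refine ⟨⟨_, hai⟩, ?_, ?_⟩
  · intro i j hi hj hij
    obtain ⟨i, rfl⟩ := Fin.exists_succ_eq.2 hi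
    obtain ⟨j, rfl⟩ := Fin.exists_succ_eq.2 hj
    have hij' : i ≠ j := fun e ↦ hij (by rw [e])
    simp only [Fin.cons_succ, dist_eq_norm]
    rw [eq_comm, Real.sqrt_eq_iff_eq_sq (by norm_num) (norm_nonneg _), norm_sub_sq_real,
      ← real_inner_self_eq_norm_sq, ← real_inner_self_eq_norm_sq, hv, hv, hv, if_neg hij',
      if_pos rfl, if_pos rfl]
    ring
  · intro i hi
    obtain ⟨i, rfl⟩ := Fin.exists_succ_eq.2 hi
    simp only [Fin.cons_succ, Fin.cons_zero, dist_zero_right]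
    rw [norm_eq_sqrt_real_inner, hv, if_pos rfl, add_comm]

theorem theorem4p7 (d : ℕ) [NeZero d] (hd : 2 ≤ d) :
    (∀ (K : Affine.Simplex ℝ (EuclideanSpace ℝ (Fin d)) d) (a : Fin (d + 1)) (s t : ℝ),
      IsKite K a s t →
        K.circumradius
            = √((d : ℝ) / (2 * (2 * (t / s) ^ 2 * d - (d - 1)))) * (t / s) ^ 2 * s ∧
        K.height a = √((2 * (t / s) ^ 2 * d - (d - 1)) / (2 * d)) * s ∧
        MeasureTheory.volume (convexHull ℝ (Set.range K.points))
            = ENNReal.ofReal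
                (1 / (d.factorial : ℝ) * √((2 * (t / s) ^ 2 * d - (d - 1)) / 2 ^ d) * s ^ d) ∧
        K.inradius
            = √(2 * (t / s) ^ 2 * d - (d - 1)) /
                (√2 * (√(d : ℝ) + d * √(2 * (t / s) ^ 2 * (d - 1) - (d - 2)))) * s ∧
        (K.circumcenter ∈ K.interior ↔ ((d : ℝ) - 1) / d < (t / s) ^ 2) ∧
        (IsEquiradial K ↔ (t / s) ^ 2 = ((d : ℝ) - 2) / d ∨ t / s = 1) ∧
        ∃ H, (∀ X, IsOrthocenter K X ↔ X = H) ∧ (H ∈ K.interior ↔ 1 / 2 < (t / s) ^ 2)) ∧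
    {x : ℝ | ∃ (K : Affine.Simplex ℝ (EuclideanSpace ℝ (Fin d)) d) (a : Fin (d + 1)) (s t : ℝ),
      IsKite K a s t ∧ x = (t / s) ^ 2} = Set.Ioi (((d : ℝ) - 1) / (2 * d)) := by
  have hd' : (0 : ℝ) < d := by positivity
  refine ⟨fun K a s t h ↦ ⟨h.circumradius_eq hd, h.height_apex_eq hd, h.volume_eq hd,
    h.inradius_eq hd, h.circumcenter_mem_interior_iff hd, h.isEquiradial_iff hd,
    h.existsUnique_orthocenter hd⟩, ?_⟩
  ext x
  simp only [Set.mem_ofPred_eq, Set.mem_Ioi, div_lt_iff₀ (mul_pos two_pos hd')]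
  constructor
  · rintro ⟨K, a, s, t, h, rfl⟩
    linarith [h.discr_pos hd]
  · intro hx
    -- a kite with `s ^ 2 = 2` and `t ^ 2 = 1 + c` has squared eccentricity `(1 + c) / 2`
    have hc : 0 < 1 + d * (2 * x - 1) := by linarith
    obtain ⟨K, hK⟩ := exists_isKite hd hc
    have h1 : (1 : ℝ) ≤ d := by exact_mod_cast (by omega : 1 ≤ d)
    have hx0 : 0 ≤ x := by
      by_contra! h
      nlinarith
    refine ⟨K, 0, _, _, hK, ?_⟩
    rw [div_pow, Real.sq_sqrt (by linarith), Real.sq_sqrt (by norm_num)]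
    ring
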